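/- Let $G$ be a locally compact second countable topological group, and let $\mathcal H_R,\mathcal H_S$ be separable complex Hilbert spaces with $\mathcal H_R\otimes\mathcal H_S$ their Hilbert space tensor product. A *state* is a positive trace class operator of trace one. Let $\mathcal R=(U_R,\mathsf E,\mathcal H_R)$ be a principal frame, i.e. $U_R$ is a strongly continuous unitary representation of $G$ in $\mathcal H_R$ and $\mathsf E:\mathcal B(G)\to B(\mathcal H_R)$ is a positive operator-valued measure on the Borel sets of $G$ with $\mathsf E(gX)=U_R(g)\mathsf E(X)U_R(g)^*$ for all $g\in G$, $X\in\mathcal B(G)$. Assume that $\mathcal R$ is localizable: $\|\mathsf E(X)\|=1$ for every $X\in\mathcal B(G)$ with $\mathsf E(X)\neq 0$. Let $U_S$ be a strongly continuous unitary representation of $G$ in $\mathcal H_S$, and let $(\omega_n)$ be a localizing sequence centred at the identity $e\in G$: a sequence of states on $\mathcal H_R$ such that the probability measures $X\mapsto \operatorname{tr}[\omega_n\mathsf E(X)]$ converge weakly to the Dirac measure $\delta_e$. For $A_S\in B(\mathcal H_S)$ let $$Y^{\mathcal R}(A_S)=\int_G d\mathsf E(g)\otimes U_S(g)A_SU_S(g)^*\in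 B(\mathcal H_R\otimes\mathcal H_S)$$ be its relativization, i.e. the operator determined by $$\langle x\otimes\varphi,\,Y^{\mathcal R}(A_S)(x\otimes\psi)\rangle=\int_G\langle\varphi,U_S(g)A_SU_S(g)^*\psi\rangle\,d\langle x,\mathsf E(g)x\rangle\qquad(x\in\mathcal H_R,\ \varphi,\psi\in\mathcal H_S),$$ and, for a state $\omega$ on $\mathcal H_R$, let $\Gamma_\omega:B(\mathcal H_R\otimes\mathcal H_S)\to B(\mathcal H_S)$ be the restriction map determined by $\operatorname{tr}[\rho\,\Gamma_\omega(T)]=\operatorname{tr}[(\omega\otimes\rho)T]$ for all states $\rho$ on $\mathcal H_S$. **Theorem.** For every $A_S\in B(\mathcal H_S)$ the operators $Y^{\mathcal R}(A_S)$ and $\Gamma_{\omega_n}(T)$ ($n\in\mathbb N$, $T\in B(\mathcal H_R\otimes\mathcal H_S)$) exist and are uniquely determined by these conditions, and $$\lim_{n\to\infty}\Gamma_{\omega_n}\bigl(Y^{\mathcal R}(A_S)\bigr)=A_S$$ ultraweakly, i.e. $\operatorname{tr}\bigl[T\,\Gamma_{\omega_n}(Y^{\mathcal R}(A_S))\bigr]\to\operatorname{tr}[T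 A_S]$ for every trace class operator $T$ on $\mathcal H_S$. -/

import Mathlib

open MeasureTheory Filter Topology
open scoped InnerProductSpace TensorProduct

namespace QRF

noncomputable section

section TraceClass

variable {H : Type*} [NormedAddCommGroup H] [InnerProductSpace ℂ H] [CompleteSpace H]

variable (H) in
/-- The index set of a fixed Hilbert basis of `H`. -/
def basisIndex : Set H := (exists_hilbertBasis ℂ H).choose

variable (H) in
/-- A fixed Hilbert (complete orthonormal) basis of `H`, used to compute traces. -/
def stdBasis : HilbertBasis (basisIndex H) ℂ H := (exists_hilbertBasis ℂ H).choose_spec.choose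

/-- `T` is trace class: `∑ᵢ ⟪bᵢ, |T| bᵢ⟫ < ∞`, where `|T| = (T* T)^{1/2}`
(the sum of these nonnegative terms does not depend on the basis). -/
def IsTraceClass (T : H →L[ℂ] H) : Prop :=
  Summable fun i => (⟪stdBasis H i, CFC.abs T (stdBasis H i)⟫_ℂ).re

/-- The trace `tr T = ∑ᵢ ⟪bᵢ, T bᵢ⟫`; for trace class `T` the sum converges absolutely and does
not depend on the basis. It is only applied to trace class operators. -/
def trace (T : H →L[ℂ] H) : ℂ :=
  ∑' i, ⟪stdBasis H i, T (stdBasis H i)⟫_ℂ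

/-- A (normal) state: a positive trace class operator of trace one. -/
structure IsState (ω : H →L[ℂ] H) : Prop where
  isPositive : ω.IsPositive
  isTraceClass : IsTraceClass ω
  trace_eq_one : trace ω = 1

/-- Ultraweak convergence `A n → B`: `tr[T A n] → tr[T B]` for every trace class operator `T`. -/
def UltraweakTendsto (A : ℕ → H →L[ℂ] H) (B : H →L[ℂ] H) : Prop :=
  ∀ T : H →L[ℂ] H, IsTraceClass T →
    Tendsto (fun n => trace (T ∘L A n)) atTop (𝓝 (trace (T ∘L B)))

end TraceClass

section Tensor

variable {H K : Type*} [NormedAddCommGroup H] [InnerProductSpace ℂ H]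
  [NormedAddCommGroup K] [InnerProductSpace ℂ K]

variable (H K) in
/-- The Hilbert space tensor product: the completion of the algebraic tensor product for
`⟪x ⊗ φ, y ⊗ ψ⟫ = ⟪x, y⟫ ⟪φ, ψ⟫`. -/
abbrev HilbertTensor : Type _ := UniformSpace.Completion (H ⊗[ℂ] K)

/-- The elementary tensor `x ⊗ φ` as a vector of the Hilbert space tensor product. -/
def tmul (x : H) (φ : K) : HilbertTensor H K := ((x ⊗ₜ[ℂ] φ : H ⊗[ℂ] K) : HilbertTensor H K)

/-- The bounded operator `S ⊗ T` on the Hilbert space tensor product. -/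
def tensorOp (S : H →L[ℂ] H) (T : K →L[ℂ] K) : HilbertTensor H K →L[ℂ] HilbertTensor H K :=
  (TensorProduct.mapL S T).completion

end Tensor

section POVM

/-- A positive operator-valued measure on the measurable space `Ω` with values in the bounded
operators on `H`. Only its values on measurable sets are relevant. -/
structure POVM (Ω : Type*) [MeasurableSpace Ω] (H : Type*) [NormedAddCommGroup H]
    [InnerProductSpace ℂ H] [CompleteSpace H] where
  /-- the effect of a set of outcomes -/
  effect : Set Ω → H →L[ℂ] H
  isPositive : ∀ X, MeasurableSet X → (effect X).IsPositive
  effect_univ : effect Set.univ = 1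
  hasSum_iUnion : ∀ X : ℕ → Set Ω, (∀ n, MeasurableSet (X n)) →
    Pairwise (Function.onFun Disjoint X) → ∀ x y : H,
      HasSum (fun n => ⟪x, effect (X n) y⟫_ℂ) ⟪x, effect (⋃ n, X n) y⟫_ℂ

variable {Ω : Type*} [MeasurableSpace Ω] {H : Type*} [NormedAddCommGroup H]
  [InnerProductSpace ℂ H] [CompleteSpace H]

theorem POVM.inner_effect_empty (E : POVM Ω H) (x y : H) : ⟪x, E.effect ∅ y⟫_ℂ = 0 := by
  have h := E.hasSum_iUnion (fun _ => ∅) (fun _ => MeasurableSet.empty)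
    (fun _ _ _ => by simp [Function.onFun]) x y
  simpa using (summable_const_iff (⟪x, E.effect ∅ y⟫_ℂ)).1 h.summable

/-- The positive measure `X ↦ ⟪x, E(X) x⟫`. -/
def POVM.vectorMeasure (E : POVM Ω H) (x : H) : Measure Ω :=
  Measure.ofMeasurable (fun X _ => ENNReal.ofReal (⟪x, E.effect X x⟫_ℂ).re)
    (by simp [E.inner_effect_empty])
    (fun X hX hd => by
      have h := Complex.hasSum_re (E.hasSum_iUnion X hX hd x x)
      have h0 : ∀ n, 0 ≤ (⟪x, E.effect (X n) x⟫_ℂ).re :=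
        fun n => (E.isPositive _ (hX n)).re_inner_nonneg_right x
      rw [← h.tsum_eq, ENNReal.ofReal_tsum_of_nonneg h0 h.summable])

theorem POVM.vectorMeasure_apply (E : POVM Ω H) (x : H) {X : Set Ω} (hX : MeasurableSet X) :
    E.vectorMeasure x X = ENNReal.ofReal (⟪x, E.effect X x⟫_ℂ).re :=
  Measure.ofMeasurable_apply X hX

/-- Norm-1 property: `‖E(X)‖ = 1` whenever `E(X) ≠ 0`. Such a POVM is called localizable. -/
def POVM.IsLocalizable (E : POVM Ω H) : Prop :=
  ∀ X, MeasurableSet X → E.effect X ≠ 0 → ‖E.effect X‖ = 1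

/-- `μ` is the outcome distribution of `E` in the state `ω` given by the Born rule,
`μ(X) = tr[ω E(X)]`. -/
def POVM.IsBornMeasure (E : POVM Ω H) (ω : H →L[ℂ] H) (μ : ProbabilityMeasure Ω) : Prop :=
  ∀ X, MeasurableSet X → (((μ : Measure Ω).real X : ℝ) : ℂ) = trace (ω ∘L E.effect X)

/-- A sequence of states whose outcome distributions converge weakly to the Dirac measure
at `x`. -/
def POVM.IsLocalizingSequence [TopologicalSpace Ω] [OpensMeasurableSpace Ω]
    (E : POVM Ω H) (x : Ω) (ω : ℕ → H →L[ℂ] H) : Prop :=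
  (∀ n, IsState (ω n)) ∧
    ∃ μ : ℕ → ProbabilityMeasure Ω,
      (∀ n, E.IsBornMeasure (ω n) (μ n)) ∧ Tendsto μ atTop (𝓝 (diracProba x))

end POVM

section Frames

/-- A strongly continuous unitary representation of `G` in `H`. -/
structure UnitaryRep (G : Type*) [Group G] [TopologicalSpace G] (H : Type*)
    [NormedAddCommGroup H] [InnerProductSpace ℂ H] [CompleteSpace H] where
  /-- the underlying homomorphism into the unitary group of `H` -/
  toHom : G →* unitary (H →L[ℂ] H)
  strongly_continuous : ∀ x : H, Continuous fun g => (toHom g : H →L[ℂ] H) x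

/-- The action `g.A = U(g) A U(g)*` on bounded operators. -/
def UnitaryRep.act {G : Type*} [Group G] [TopologicalSpace G] {H : Type*}
    [NormedAddCommGroup H] [InnerProductSpace ℂ H] [CompleteSpace H]
    (U : UnitaryRep G H) (g : G) (A : H →L[ℂ] H) : H →L[ℂ] H :=
  (U.toHom g : H →L[ℂ] H) ∘L A ∘L ContinuousLinearMap.adjoint (U.toHom g : H →L[ℂ] H)

/-- A quantum reference frame based on the homogeneous `G`-space `Ω`: a system of covariance,
i.e. a strongly continuous unitary representation together with a covariant POVM on the Borel
sets of `Ω`. -/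
structure Frame (G : Type*) [Group G] [TopologicalSpace G]
    (Ω : Type*) [TopologicalSpace Ω] [MeasurableSpace Ω] [BorelSpace Ω]
    [MulAction G Ω] [ContinuousSMul G Ω] [MulAction.IsPretransitive G Ω]
    (H : Type*) [NormedAddCommGroup H] [InnerProductSpace ℂ H] [CompleteSpace H] where
  /-- the unitary representation of the frame -/
  rep : UnitaryRep G H
  /-- the frame observable -/
  obs : POVM Ω H
  covariant : ∀ (g : G) (X : Set Ω), MeasurableSet X →
    obs.effect ((fun s => g • s) '' X) = rep.act g (obs.effect X)

/-- A principal frame: a frame based on `G` itself, acting by left translations. -/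
abbrev PrincipalFrame (G : Type*) [Group G] [TopologicalSpace G] [IsTopologicalGroup G]
    [MeasurableSpace G] [BorelSpace G]
    (H : Type*) [NormedAddCommGroup H] [InnerProductSpace ℂ H] [CompleteSpace H] :=
  Frame G G H

variable {G : Type*} [Group G] [TopologicalSpace G] [IsTopologicalGroup G]
  [MeasurableSpace G] [BorelSpace G]
  {HR : Type*} [NormedAddCommGroup HR] [InnerProductSpace ℂ HR] [CompleteSpace HR]
  {HS : Type*} [NormedAddCommGroup HS] [InnerProductSpace ℂ HS] [CompleteSpace HS]

/-- `Y = ∫_G dE(g) ⊗ U(g) A U(g)*`, the operator-valued integral being understood weakly: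
`⟪x ⊗ φ, Y (x ⊗ ψ)⟫ = ∫_G ⟪φ, U(g) A U(g)* ψ⟫ dμ_x(g)` with `μ_x(X) = ⟪x, E(X) x⟫`.
(By polarization in `x` this determines `Y`.) -/
def IsRelativization (R : PrincipalFrame G HR) (U : UnitaryRep G HS) (A : HS →L[ℂ] HS)
    (Y : HilbertTensor HR HS →L[ℂ] HilbertTensor HR HS) : Prop :=
  ∀ (x : HR) (φ ψ : HS),
    ⟪tmul x φ, Y (tmul x ψ)⟫_ℂ = ∫ g, ⟪φ, U.act g A ψ⟫_ℂ ∂(R.obs.vectorMeasure x)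

open Classical in
/-- The relativization map `A ↦ ∫_G dE(g) ⊗ U(g) A U(g)*`. The value `0` stands for the case
that no such operator exists, which never occurs. -/
def relativization (R : PrincipalFrame G HR) (U : UnitaryRep G HS) (A : HS →L[ℂ] HS) :
    HilbertTensor HR HS →L[ℂ] HilbertTensor HR HS :=
  if h : ∃ Y, IsRelativization R U A Y then h.choose else 0

/-- `B` is the restriction of `T` given `ω`: `tr[ρ B] = tr[(ω ⊗ ρ) T]` for all states `ρ`. -/
def IsRestriction (ω : HR →L[ℂ] HR) (T : HilbertTensor HR HS →L[ℂ] HilbertTensor HR HS)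
    (B : HS →L[ℂ] HS) : Prop :=
  ∀ ρ : HS →L[ℂ] HS, IsState ρ → trace (ρ ∘L B) = trace (tensorOp ω ρ ∘L T)

open Classical in
/-- The restriction map `Γ_ω`. The value `0` stands for the case that no operator with the
defining property exists, which never occurs when `ω` is a state. -/
def restriction (ω : HR →L[ℂ] HR) (T : HilbertTensor HR HS →L[ℂ] HilbertTensor HR HS) :
    HS →L[ℂ] HS :=
  if h : ∃ B, IsRestriction ω T B then h.choose else 0

end Frames

end

end QRF

namespace QRF

noncomputable section

/-! ### Hilbert–Schmidt and trace class operators. -/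

section HilbertSchmidt

variable {ι κ : Type*} {H : Type*} [NormedAddCommGroup H] [InnerProductSpace ℂ H]

/-! A state factors as `ω = s ∘ s` with `s` self-adjoint and Hilbert–Schmidt, so it is a mixture of
the unnormalized vector states at `s bₖ`. Hence `Γ_ω(T) = ∑ₖ Vₖ* T Vₖ` with `Vₖ φ = s bₖ ⊗ φ`.
Inserting the relativization turns each term into an integral of `⟪φ, g.A ψ⟫` against the vector
measure at `s bₖ`. These measures add up to the Born measure `μ` of `ω`, so `⟪φ, Γ_ω(Y) ψ⟫ = ∫ ⟪φ,
g.A ψ⟫ dμ` (`inner_restriction_relativization`).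

The integrand is bounded and continuous in `g`. Weak convergence to the Dirac measure at the
identity therefore gives `⟪φ, A ψ⟫` in the limit. All restrictions have norm at most `‖A‖`, and
bounded weak convergence is ultraweak because a trace class operator is a product of two
Hilbert–Schmidt operators (`ultraweakTendsto_of_weak`).

The relativization exists as a weak limit of integrals of simple functions, which are uniformly
bounded by `‖A‖` (`norm_sum_tensorOp_le`, `exists_weak_limit`). -/

theorem hasSum_norm_inner_sq (b : HilbertBasis ι ℂ H) (x : H) :
    HasSum (fun i => ‖⟪b i, x⟫_ℂ‖ ^ 2) (‖x‖ ^ 2) := by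
  have h := b.hasSum_inner_mul_inner x x
  have e : ∀ i, ⟪x, b i⟫_ℂ * ⟪b i, x⟫_ℂ = ((‖⟪b i, x⟫_ℂ‖ ^ 2 : ℝ) : ℂ) := fun i => by
    rw [← inner_conj_symm x (b i), Complex.conj_mul']
    push_cast; rfl
  simp only [e] at h
  rw [inner_self_eq_norm_sq_to_K] at h
  have h' : HasSum (fun i => ((‖⟪b i, x⟫_ℂ‖ ^ 2 : ℝ) : ℂ)) ((‖x‖ : ℂ) ^ 2) := h
  rw [← Complex.ofReal_pow] at h'
  exact Complex.hasSum_ofReal.1 h'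

theorem ext_inner_self_right {B C : H →L[ℂ] H} (h : ∀ x, ⟪x, B x⟫_ℂ = ⟪x, C x⟫_ℂ) : B = C := by
  refine ContinuousLinearMap.coe_injective ((ext_inner_map _ _).1 fun x => ?_)
  rw [← inner_conj_symm]
  exact (congrArg _ (h x)).trans (inner_conj_symm _ _)

theorem summable_prod_inner_sq (b : HilbertBasis ι ℂ H) (c : HilbertBasis κ ℂ H) {T : H →L[ℂ] H}
    (h : Summable fun i => ‖T (b i)‖ ^ 2) :
    Summable fun p : ι × κ => ‖⟪c p.2, T (b p.1)⟫_ℂ‖ ^ 2 := by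
  refine (summable_prod_of_nonneg fun _ => by positivity).2
    ⟨fun i => (hasSum_norm_inner_sq c (T (b i))).summable, ?_⟩
  simpa only [(hasSum_norm_inner_sq c (T (b _))).tsum_eq] using h

variable [CompleteSpace H]

/-- Sum `‖⟪c j, T (b i)⟫‖ ^ 2` in the other order. As `b` and `c` are unrelated, two applications
give basis independence of the Hilbert–Schmidt condition. -/
theorem summable_adjoint (b : HilbertBasis ι ℂ H) (c : HilbertBasis κ ℂ H) {T : H →L[ℂ] H}
    (h : Summable fun i => ‖T (b i)‖ ^ 2) :
    Summable fun j => ‖ContinuousLinearMap.adjoint T (c j)‖ ^ 2 := by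
  have h1 := (summable_prod_inner_sq b c h).prod_symm.prod
  refine h1.congr fun j => ?_
  rw [← (hasSum_norm_inner_sq b (ContinuousLinearMap.adjoint T (c j))).tsum_eq]
  refine tsum_congr fun i => ?_
  rw [ContinuousLinearMap.adjoint_inner_right, ← inner_conj_symm, RCLike.norm_conj]
  rfl

/-- `T` is Hilbert–Schmidt. -/
def IsHilbertSchmidt (T : H →L[ℂ] H) : Prop :=
  Summable fun i => ‖T (stdBasis H i)‖ ^ 2

theorem IsHilbertSchmidt.of_basis (b : HilbertBasis ι ℂ H) {T : H →L[ℂ] H}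
    (h : Summable fun i => ‖T (b i)‖ ^ 2) : IsHilbertSchmidt T := by
  have := summable_adjoint (stdBasis H) (stdBasis H) (summable_adjoint b (stdBasis H) h)
  rwa [ContinuousLinearMap.adjoint_adjoint] at this

theorem IsHilbertSchmidt.adjoint {T : H →L[ℂ] H} (h : IsHilbertSchmidt T) :
    IsHilbertSchmidt (ContinuousLinearMap.adjoint T) :=
  summable_adjoint _ _ h

theorem IsHilbertSchmidt.summable {T : H →L[ℂ] H} (h : IsHilbertSchmidt T)
    (c : HilbertBasis κ ℂ H) : Summable fun j => ‖T (c j)‖ ^ 2 := by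
  simpa using summable_adjoint (stdBasis H) c h.adjoint

theorem IsHilbertSchmidt.comp_left {T : H →L[ℂ] H} (h : IsHilbertSchmidt T) (B : H →L[ℂ] H) :
    IsHilbertSchmidt (B ∘L T) := by
  refine (Summable.mul_left (‖B‖ ^ 2) h).of_nonneg_of_le (fun _ => by positivity) fun i => ?_
  rw [← mul_pow]
  gcongr
  exact B.le_opNorm _

theorem IsHilbertSchmidt.comp_right {T : H →L[ℂ] H} (h : IsHilbertSchmidt T) (B : H →L[ℂ] H) :
    IsHilbertSchmidt (T ∘L B) := by
  have := (h.adjoint.comp_left (ContinuousLinearMap.adjoint B)).adjoint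
  simpa [ContinuousLinearMap.adjoint_comp] using this

/-- The trace of a product of two Hilbert–Schmidt operators, computed in an arbitrary basis. -/
theorem hasSum_trace_comp {X Y : H →L[ℂ] H} (hX : IsHilbertSchmidt X) (hY : IsHilbertSchmidt Y)
    (c : HilbertBasis κ ℂ H) :
    HasSum (fun j => ⟪c j, Y (X (c j))⟫_ℂ) (trace (X ∘L Y)) := by
  set b := stdBasis H
  have hs : Summable fun p : basisIndex H × κ =>
      ⟪ContinuousLinearMap.adjoint X (b p.1), c p.2⟫_ℂ * ⟪c p.2, Y (b p.1)⟫_ℂ := by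
    -- The arithmetic–geometric mean inequality gives absolute summability, so both iterated sums
    -- agree.
    refine Summable.of_norm_bounded
      ((summable_prod_inner_sq b c hX.adjoint).add (summable_prod_inner_sq b c hY)) fun p => ?_
    rw [norm_mul, norm_inner_symm]
    nlinarith [sq_nonneg (‖⟪c p.2, ContinuousLinearMap.adjoint X (b p.1)⟫_ℂ‖
      - ‖⟪c p.2, Y (b p.1)⟫_ℂ‖), sq_nonneg (‖⟪c p.2, ContinuousLinearMap.adjoint X (b p.1)⟫_ℂ‖),
      sq_nonneg ‖⟪c p.2, Y (b p.1)⟫_ℂ‖]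
  have h1 : ∀ i, HasSum (fun j =>
      ⟪ContinuousLinearMap.adjoint X (b i), c j⟫_ℂ * ⟪c j, Y (b i)⟫_ℂ) ⟪b i, X (Y (b i))⟫_ℂ := by
    intro i
    rw [← ContinuousLinearMap.adjoint_inner_left]
    exact c.hasSum_inner_mul_inner _ _
  have h2 : ∀ j, HasSum (fun i =>
      ⟪ContinuousLinearMap.adjoint X (b i), c j⟫_ℂ * ⟪c j, Y (b i)⟫_ℂ) ⟪c j, Y (X (c j))⟫_ℂ := by
    intro j
    rw [← ContinuousLinearMap.adjoint_inner_left]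
    have h := b.hasSum_inner_mul_inner (ContinuousLinearMap.adjoint Y (c j)) (X (c j))
    refine h.congr_fun fun i => ?_
    rw [ContinuousLinearMap.adjoint_inner_left, ContinuousLinearMap.adjoint_inner_left, mul_comm]
  have h3 := hs.hasSum.prod_fiberwise h1
  have h4 := hs.prod_symm.hasSum.prod_fiberwise h2
  have e : trace (X ∘L Y) = ∑' p : basisIndex H × κ,
      ⟪ContinuousLinearMap.adjoint X (b p.1), c p.2⟫_ℂ * ⟪c p.2, Y (b p.1)⟫_ℂ := h3.tsum_eq
  rw [e, ← (Equiv.prodComm κ (basisIndex H)).tsum_eq]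
  exact h4

/-- Every bounded positive operator is the square of a bounded self-adjoint operator. -/
theorem exists_sqrt {P : H →L[ℂ] H} (hP : P.IsPositive) :
    ∃ s : H →L[ℂ] H, ContinuousLinearMap.adjoint s = s ∧ s ∘L s = P := by
  have h0 : 0 ≤ P := (ContinuousLinearMap.nonneg_iff_isPositive P).2 hP
  refine ⟨CFC.sqrt P, ?_, CFC.sqrt_mul_sqrt_self P h0⟩
  exact (IsSelfAdjoint.of_nonneg (CFC.sqrt_nonneg P)).star_eq

theorem inner_sq_self {s : H →L[ℂ] H} (hs : ContinuousLinearMap.adjoint s = s) (x y : H) :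
    ⟪x, s (s y)⟫_ℂ = ⟪s x, s y⟫_ℂ := by
  rw [← ContinuousLinearMap.adjoint_inner_left, hs]

/-- Since `⟪bᵢ, |T| bᵢ⟫ = ‖s bᵢ‖ ^ 2`, the trace class condition on `T` is the Hilbert–Schmidt
condition on `s`. -/
theorem exists_hilbertSchmidt_sqrt_abs {T : H →L[ℂ] H} (hT : IsTraceClass T) :
    ∃ s : H →L[ℂ] H, ContinuousLinearMap.adjoint s = s ∧ s ∘L s = CFC.abs T ∧
      IsHilbertSchmidt s := by
  obtain ⟨s, hs, hss⟩ := exists_sqrt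
    ((ContinuousLinearMap.nonneg_iff_isPositive _).1 (CFC.abs_nonneg T))
  refine ⟨s, hs, hss, hT.congr fun i => ?_⟩
  rw [← hss, ContinuousLinearMap.comp_apply, inner_sq_self hs]
  exact (inner_self_eq_norm_sq (𝕜 := ℂ) _)

theorem norm_abs_apply (T : H →L[ℂ] H) (x : H) : ‖CFC.abs T x‖ = ‖T x‖ := by
  have h1 : ContinuousLinearMap.adjoint (CFC.abs T) = CFC.abs T :=
    (IsSelfAdjoint.of_nonneg (CFC.abs_nonneg T)).star_eq
  have h2 : CFC.abs T (CFC.abs T x) = ContinuousLinearMap.adjoint T (T x) :=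
    DFunLike.congr_fun (CFC.abs_mul_abs T) x
  have h3 : ⟪CFC.abs T x, CFC.abs T x⟫_ℂ = ⟪T x, T x⟫_ℂ := by
    rw [← inner_sq_self h1, h2, ContinuousLinearMap.adjoint_inner_right]
  rw [inner_self_eq_norm_sq_to_K, inner_self_eq_norm_sq_to_K] at h3
  have h4 : ‖CFC.abs T x‖ ^ 2 = ‖T x‖ ^ 2 := by exact_mod_cast h3
  exact (sq_eq_sq₀ (norm_nonneg _) (norm_nonneg _)).1 h4

/-- By `norm_abs_apply`, `|T| x ↦ T x` is isometric on the range of `|T|`. Extend it to the closure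
and precompose with the orthogonal projection. -/
theorem exists_polar (T : H →L[ℂ] H) : ∃ V : H →L[ℂ] H, V ∘L CFC.abs T = T := by
  set p := CFC.abs T
  let K : Submodule ℂ H := (LinearMap.range p.toLinearMap).topologicalClosure
  have hK : IsClosed (K : Set H) := Submodule.isClosed_topologicalClosure _
  have : CompleteSpace K := hK.completeSpace_coe
  have hmem : ∀ x, p x ∈ K := fun x => Submodule.le_topologicalClosure _ ⟨x, rfl⟩
  let e : H →ₗ[ℂ] K := p.toLinearMap.codRestrict K hmem
  have hd : DenseRange e := by
    rw [DenseRange, Subtype.dense_iff]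
    intro x hx
    have hx' : x ∈ closure (Set.range p) := hx
    rwa [← Set.range_comp]
  refine ⟨(T.toLinearMap.extendOfNorm e) ∘L K.orthogonalProjectionOnto, ?_⟩
  ext x
  have h1 : K.orthogonalProjectionOnto (p x) = e x :=
    Submodule.orthogonalProjectionOnto_mem_subspace_eq_self (K := K) (e x)
  rw [ContinuousLinearMap.comp_apply, ContinuousLinearMap.comp_apply, h1,
    LinearMap.extendOfNorm_eq hd ⟨1, fun x => ?_⟩]
  · rfl
  · rw [one_mul]
    exact (norm_abs_apply T x).ge

theorem IsTraceClass.exists_factor {T : H →L[ℂ] H} (hT : IsTraceClass T) :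
    ∃ X Y : H →L[ℂ] H, IsHilbertSchmidt X ∧ IsHilbertSchmidt Y ∧ T = X ∘L Y := by
  obtain ⟨s, -, hss, hs⟩ := exists_hilbertSchmidt_sqrt_abs hT
  obtain ⟨V, hV⟩ := exists_polar T
  exact ⟨V ∘L s, s, hs.comp_left V, hs, by rw [ContinuousLinearMap.comp_assoc, hss, hV]⟩

theorem IsState.exists_sqrt {ω : H →L[ℂ] H} (hω : IsState ω) :
    ∃ s : H →L[ℂ] H, ContinuousLinearMap.adjoint s = s ∧ s ∘L s = ω ∧ IsHilbertSchmidt s := by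
  have := exists_hilbertSchmidt_sqrt_abs hω.isTraceClass
  rwa [CFC.abs_of_nonneg ω ((ContinuousLinearMap.nonneg_iff_isPositive ω).2 hω.isPositive)] at this

theorem hasSum_trace_sq_comp {s : H →L[ℂ] H} (hs : ContinuousLinearMap.adjoint s = s)
    (hHS : IsHilbertSchmidt s) (B : H →L[ℂ] H) (c : HilbertBasis κ ℂ H) :
    HasSum (fun j => ⟪s (c j), B (s (c j))⟫_ℂ) (trace ((s ∘L s) ∘L B)) := by
  have h := hasSum_trace_comp hHS (hHS.comp_right B) c
  rw [← ContinuousLinearMap.comp_assoc] at h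
  refine h.congr_fun fun j => ?_
  rw [ContinuousLinearMap.comp_apply, ← ContinuousLinearMap.adjoint_inner_left s, hs]

theorem trace_rankOne_comp (x : H) (B : H →L[ℂ] H) :
    trace (InnerProductSpace.rankOne ℂ x x ∘L B) = ⟪x, B x⟫_ℂ := by
  rw [← ContinuousLinearMap.adjoint_inner_left, ← (stdBasis H).tsum_inner_mul_inner, trace]
  refine tsum_congr fun i => ?_
  simp [ContinuousLinearMap.adjoint_inner_left]

theorem isState_rankOne {x : H} (hx : ‖x‖ = 1) : IsState (InnerProductSpace.rankOne ℂ x x) where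
  isPositive := InnerProductSpace.isPositive_rankOne_self x
  isTraceClass := by
    rw [IsTraceClass, CFC.abs_of_nonneg _ ((ContinuousLinearMap.nonneg_iff_isPositive _).2
      (InnerProductSpace.isPositive_rankOne_self x))]
    refine (hasSum_norm_inner_sq (stdBasis H) x).summable.congr fun i => ?_
    rw [InnerProductSpace.rankOne_apply, inner_smul_right, ← inner_conj_symm x, Complex.conj_mul']
    norm_cast
  trace_eq_one := by
    have h := trace_rankOne_comp x (1 : H →L[ℂ] H)
    rw [ContinuousLinearMap.one_def, ContinuousLinearMap.comp_id] at h
    rw [h, ContinuousLinearMap.id_apply, inner_self_eq_norm_sq_to_K, hx]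
    simp

/-- Bounded operators are determined by their expectation values in all states. -/
theorem eq_of_forall_trace_eq {B C : H →L[ℂ] H}
    (h : ∀ ρ : H →L[ℂ] H, IsState ρ → trace (ρ ∘L B) = trace (ρ ∘L C)) : B = C := by
  refine ext_inner_self_right fun x => ?_
  rcases eq_or_ne x 0 with rfl | hx
  · simp
  have hx' : ‖x‖ ≠ 0 := norm_ne_zero_iff.2 hx
  -- Only unit vectors give pure states, so normalize and scale back.
  set u : H := ((‖x‖ : ℂ)⁻¹) • x with hu
  have hu1 : ‖u‖ = 1 := by simp [hu, norm_smul, hx']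
  have hxu : x = (‖x‖ : ℂ) • u := by rw [hu, smul_inv_smul₀ (by exact_mod_cast hx')]
  have h1 := h _ (isState_rankOne hu1)
  rw [trace_rankOne_comp, trace_rankOne_comp] at h1
  rw [hxu]
  simp only [map_smul, inner_smul_left, inner_smul_right, h1]

/-- Bounded weak operator convergence implies ultraweak convergence. -/
theorem ultraweakTendsto_of_weak {A : ℕ → H →L[ℂ] H} {B : H →L[ℂ] H} {C : ℝ}
    (hC : ∀ n, ‖A n‖ ≤ C)
    (h : ∀ x y : H, Tendsto (fun n => ⟪x, A n y⟫_ℂ) atTop (𝓝 ⟪x, B y⟫_ℂ)) :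
    UltraweakTendsto A B := by
  intro T hT
  obtain ⟨X, Y, hX, hY, rfl⟩ := hT.exists_factor
  set b := stdBasis H
  -- Cyclicity places one Hilbert–Schmidt factor on each side of `D`: every term is a matrix
  -- coefficient of `D` with a square-summable bound.
  have key : ∀ D : H →L[ℂ] H, trace ((X ∘L Y) ∘L D) =
      ∑' j, ⟪ContinuousLinearMap.adjoint Y (b j), D (X (b j))⟫_ℂ := by
    intro D
    rw [ContinuousLinearMap.comp_assoc, ← (hasSum_trace_comp hX (hY.comp_right D) b).tsum_eq]
    exact tsum_congr fun j => (ContinuousLinearMap.adjoint_inner_left Y _ _).symm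
  simp only [key]
  refine tendsto_tsum_of_dominated_convergence
    (bound := fun j => C * (‖ContinuousLinearMap.adjoint Y (b j)‖ ^ 2 + ‖X (b j)‖ ^ 2))
    ((hY.adjoint.summable b).add (hX.summable b) |>.mul_left C) (fun j => h _ _)
    (Eventually.of_forall fun n j => ?_)
  have hC0 : 0 ≤ C := (norm_nonneg _).trans (hC 0)
  calc _ ≤ ‖ContinuousLinearMap.adjoint Y (b j)‖ * (C * ‖X (b j)‖) :=
        (norm_inner_le_norm _ _).trans (by gcongr; exact (A n).le_of_opNorm_le (hC n) _)
    _ = C * (‖ContinuousLinearMap.adjoint Y (b j)‖ * ‖X (b j)‖) := by ring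
    _ ≤ _ := by
      gcongr
      nlinarith [sq_nonneg (‖ContinuousLinearMap.adjoint Y (b j)‖ - ‖X (b j)‖),
        sq_nonneg ‖ContinuousLinearMap.adjoint Y (b j)‖, sq_nonneg ‖X (b j)‖]

end HilbertSchmidt

/-! ### Operators and bases on the Hilbert space tensor product. -/

section Tensor

variable {ι κ : Type*} {H K : Type*} [NormedAddCommGroup H] [InnerProductSpace ℂ H]
  [NormedAddCommGroup K] [InnerProductSpace ℂ K]

theorem inner_tmul (x y : H) (φ ψ : K) :
    ⟪tmul x φ, tmul y ψ⟫_ℂ = ⟪x, y⟫_ℂ * ⟪φ, ψ⟫_ℂ := by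
  rw [tmul, tmul, UniformSpace.Completion.inner_coe, TensorProduct.inner_tmul]

theorem norm_tmul (x : H) (φ : K) : ‖tmul x φ‖ = ‖x‖ * ‖φ‖ := by
  rw [tmul, UniformSpace.Completion.norm_coe, TensorProduct.norm_tmul]

variable (H K) in
/-- The elementary tensor as a continuous bilinear map. -/
def tmulBilin : H →L[ℂ] K →L[ℂ] HilbertTensor H K :=
  (ContinuousLinearMap.compL ℂ K (H ⊗[ℂ] K) (HilbertTensor H K)
    UniformSpace.Completion.toComplL) ∘L TensorProduct.mkL ℂ H K

theorem tmulBilin_apply (x : H) (φ : K) : tmulBilin H K x φ = tmul x φ := rfl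

theorem norm_tmulBilin_apply_le (x : H) : ‖tmulBilin H K x‖ ≤ ‖x‖ :=
  ContinuousLinearMap.opNorm_le_bound _ (norm_nonneg _) fun φ => (norm_tmul x φ).le

theorem eq_top_of_forall_tmul_mem {M : Submodule ℂ (HilbertTensor H K)}
    (hM : IsClosed (M : Set (HilbertTensor H K))) (h : ∀ x φ, tmul x φ ∈ M) : M = ⊤ := by
  rw [Submodule.eq_top_iff']
  intro u
  induction u using UniformSpace.Completion.induction_on with
  | hp => exact hM
  | ih t =>
    induction t using TensorProduct.induction_on with
    | zero => rw [UniformSpace.Completion.coe_zero]; exact M.zero_mem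
    | tmul x φ => exact h x φ
    | add a b ha hb => rw [UniformSpace.Completion.coe_add]; exact M.add_mem ha hb

theorem ext_tmul {F : Type*} [NormedAddCommGroup F] [NormedSpace ℂ F]
    {D E : HilbertTensor H K →L[ℂ] F} (h : ∀ x φ, D (tmul x φ) = E (tmul x φ)) : D = E := by
  have hM : (LinearMap.eqLocus D.toLinearMap E.toLinearMap) = ⊤ :=
    eq_top_of_forall_tmul_mem (isClosed_eq D.continuous E.continuous) h
  ext u
  exact (Submodule.eq_top_iff'.1 hM) u

theorem ext_inner_tmul {D E : HilbertTensor H K →L[ℂ] HilbertTensor H K}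
    (h : ∀ x φ y ψ, ⟪tmul x φ, D (tmul y ψ)⟫_ℂ = ⟪tmul x φ, E (tmul y ψ)⟫_ℂ) : D = E := by
  refine ext_tmul fun y ψ => ext_inner_left ℂ fun v => ?_
  -- Only equality of the two functionals matters; the outer `adjoint` is stripped by `congr 1` and
  -- cancelled by injectivity.
  have : ContinuousLinearMap.adjoint (innerSL ℂ (D (tmul y ψ)) : HilbertTensor H K →L[ℂ] ℂ)
      = ContinuousLinearMap.adjoint (innerSL ℂ (E (tmul y ψ))) := by
    congr 1
    refine ext_tmul fun x φ => ?_
    rw [innerSL_apply_apply, innerSL_apply_apply, ← inner_conj_symm, h, inner_conj_symm]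
  have h2 : innerSL ℂ (D (tmul y ψ)) v = innerSL ℂ (E (tmul y ψ)) v := by
    rw [ContinuousLinearMap.adjoint.injective this]
  rw [innerSL_apply_apply, innerSL_apply_apply] at h2
  rw [← inner_conj_symm, h2, inner_conj_symm]

theorem tensorOp_tmul (S : H →L[ℂ] H) (T : K →L[ℂ] K) (x : H) (φ : K) :
    tensorOp S T (tmul x φ) = tmul (S x) (T φ) := by
  rw [tensorOp, tmul, ContinuousLinearMap.completion_apply_coe, TensorProduct.mapL_tmul, tmul]

theorem tensorOp_comp (S S' : H →L[ℂ] H) (T T' : K →L[ℂ] K) :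
    tensorOp (S ∘L S') (T ∘L T') = tensorOp S T ∘L tensorOp S' T' :=
  ext_tmul fun x φ => by simp [tensorOp_tmul]

theorem tensorOp_one : tensorOp (1 : H →L[ℂ] H) (1 : K →L[ℂ] K) = 1 :=
  ext_tmul fun x φ => by simp [tensorOp_tmul]

theorem tensorOp_sum_left (s : Finset ι) (S : ι → H →L[ℂ] H) (T : K →L[ℂ] K) :
    tensorOp (∑ i ∈ s, S i) T = ∑ i ∈ s, tensorOp (S i) T :=
  ext_tmul fun x φ => by
    simp only [tensorOp_tmul, sum_apply]
    simp only [← tmulBilin_apply, map_sum, sum_apply]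

theorem norm_tensorOp_le (S : H →L[ℂ] H) (T : K →L[ℂ] K) : ‖tensorOp S T‖ ≤ ‖S‖ * ‖T‖ := by
  refine ContinuousLinearMap.opNorm_le_bound _ (by positivity) fun u => ?_
  induction u using UniformSpace.Completion.induction_on with
  | hp => exact isClosed_le (by fun_prop) (by fun_prop)
  | ih t =>
    rw [tensorOp, ContinuousLinearMap.completion_apply_coe, UniformSpace.Completion.norm_coe,
      UniformSpace.Completion.norm_coe]
    exact ContinuousLinearMap.le_of_opNorm_le _ (TensorProduct.norm_mapL_le S T) t

theorem tensorOp_adjoint [CompleteSpace H] [CompleteSpace K] (S : H →L[ℂ] H) (T : K →L[ℂ] K) :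
    ContinuousLinearMap.adjoint (tensorOp S T) =
      tensorOp (ContinuousLinearMap.adjoint S) (ContinuousLinearMap.adjoint T) :=
  ext_inner_tmul fun x φ y ψ => by
    simp only [ContinuousLinearMap.adjoint_inner_right, tensorOp_tmul, inner_tmul]

theorem orthonormal_tmul (b : HilbertBasis ι ℂ H) (c : HilbertBasis κ ℂ K) :
    Orthonormal ℂ fun p : ι × κ => tmul (b p.1) (c p.2) := by
  classical
  rw [orthonormal_iff_ite]
  rintro ⟨i, j⟩ ⟨i', j'⟩
  rw [inner_tmul, orthonormal_iff_ite.1 b.orthonormal, orthonormal_iff_ite.1 c.orthonormal]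
  by_cases h : i = i' <;> by_cases h' : j = j' <;> simp [h, h']

/-- Approximate one factor at a time: fix `b i` and fill out `K`, then fix `φ` and fill out `H`. -/
theorem dense_span_tmul (b : HilbertBasis ι ℂ H) (c : HilbertBasis κ ℂ K) :
    (Submodule.span ℂ
      (Set.range fun p : ι × κ => tmul (b p.1) (c p.2))).topologicalClosure = ⊤ := by
  set M := (Submodule.span ℂ
      (Set.range fun p : ι × κ => tmul (b p.1) (c p.2))).topologicalClosure
  have hM : IsClosed (M : Set (HilbertTensor H K)) := Submodule.isClosed_topologicalClosure _
  have h0 : ∀ i j, tmul (b i) (c j) ∈ M := fun i j =>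
    Submodule.le_topologicalClosure _ (Submodule.subset_span ⟨(i, j), rfl⟩)
  have h1 : ∀ i φ, tmul (b i) φ ∈ M := by
    intro i φ
    have : (Submodule.span ℂ (Set.range c)).topologicalClosure ≤
        M.comap (tmulBilin H K (b i)).toLinearMap := by
      refine Submodule.topologicalClosure_minimal _ (Submodule.span_le.2 ?_)
        (hM.preimage (tmulBilin H K (b i)).continuous)
      rintro _ ⟨j, rfl⟩
      exact h0 i j
    rw [c.dense_span] at this
    exact this (Submodule.mem_top (x := φ))
  refine eq_top_of_forall_tmul_mem hM fun x φ => ?_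
  have : (Submodule.span ℂ (Set.range b)).topologicalClosure ≤
      M.comap ((tmulBilin H K).flip φ).toLinearMap := by
    refine Submodule.topologicalClosure_minimal _ (Submodule.span_le.2 ?_)
      (hM.preimage ((tmulBilin H K).flip φ).continuous)
    rintro _ ⟨i, rfl⟩
    exact h1 i φ
  rw [b.dense_span] at this
  exact this (Submodule.mem_top (x := x))

/-- The product of two Hilbert bases. -/
def tensorBasis (b : HilbertBasis ι ℂ H) (c : HilbertBasis κ ℂ K) :
    HilbertBasis (ι × κ) ℂ (HilbertTensor H K) :=
  HilbertBasis.mk (orthonormal_tmul b c) (dense_span_tmul b c).ge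

theorem tensorBasis_apply (b : HilbertBasis ι ℂ H) (c : HilbertBasis κ ℂ K) (p : ι × κ) :
    tensorBasis b c p = tmul (b p.1) (c p.2) := by
  rw [tensorBasis, HilbertBasis.coe_mk]

end Tensor

/-! ### Existence, uniqueness and an explicit form of the restriction map. -/

section Restriction

variable {κ : Type*} {H K : Type*} [NormedAddCommGroup H] [InnerProductSpace ℂ H]
  [NormedAddCommGroup K] [InnerProductSpace ℂ K] [CompleteSpace K]

/-- With `Vₖ φ = x k ⊗ φ`, the series `∑ₖ Vₖ* T Vₖ` converges in norm because `‖Vₖ‖ ≤ ‖x k‖`. -/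
theorem exists_partial_expectation {x : κ → H} (hx : Summable fun k => ‖x k‖ ^ 2)
    (T : HilbertTensor H K →L[ℂ] HilbertTensor H K) :
    ∃ B : K →L[ℂ] K, ∀ φ ψ : K,
      HasSum (fun k => ⟪tmul (x k) φ, T (tmul (x k) ψ)⟫_ℂ) ⟪φ, B ψ⟫_ℂ := by
  set D : κ → K →L[ℂ] K := fun k =>
    ContinuousLinearMap.adjoint (tmulBilin H K (x k)) ∘L T ∘L tmulBilin H K (x k)
  have hD : Summable D := by
    refine Summable.of_norm_bounded (hx.mul_right ‖T‖) fun k => ?_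
    calc ‖D k‖ ≤ ‖x k‖ * (‖T‖ * ‖x k‖) := by
          refine (ContinuousLinearMap.opNorm_comp_le _ _).trans ?_
          rw [LinearIsometryEquiv.norm_map]
          gcongr
          · exact norm_tmulBilin_apply_le _
          · refine (ContinuousLinearMap.opNorm_comp_le _ _).trans ?_
            gcongr
            exact norm_tmulBilin_apply_le _
      _ = _ := by ring
  refine ⟨∑' k, D k, fun φ ψ => ?_⟩
  have h := (innerSL ℂ φ).hasSum ((ContinuousLinearMap.apply ℂ K ψ).hasSum hD.hasSum)
  refine h.congr_fun fun k => ?_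
  simp only [D, ContinuousLinearMap.apply_apply, innerSL_apply_apply,
    ContinuousLinearMap.comp_apply, ContinuousLinearMap.adjoint_inner_right, tmulBilin_apply]

variable [CompleteSpace H]

theorem IsHilbertSchmidt.tensorOp {s : H →L[ℂ] H} {r : K →L[ℂ] K} (hs : IsHilbertSchmidt s)
    (hr : IsHilbertSchmidt r) : IsHilbertSchmidt (tensorOp s r) := by
  refine .of_basis (tensorBasis (stdBasis H) (stdBasis K)) ?_
  refine (Summable.mul_of_nonneg hs hr (fun _ => by positivity) (fun _ => by positivity)).congr
    fun p => ?_
  rw [tensorBasis_apply, tensorOp_tmul, norm_tmul, mul_pow]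

/-- Write `ρ = r ∘ r`. Then `ω ⊗ ρ = (s ⊗ r) ∘ (s ⊗ r)`, and its trace against `T` in the product
basis is summed over the `H` index first, leaving the expectation of `B`. -/
theorem isRestriction_of_hasSum {s : H →L[ℂ] H} (hs : ContinuousLinearMap.adjoint s = s)
    (hHS : IsHilbertSchmidt s) {T : HilbertTensor H K →L[ℂ] HilbertTensor H K} {B : K →L[ℂ] K}
    (hB : ∀ φ ψ : K, HasSum (fun k => ⟪tmul (s (stdBasis H k)) φ,
      T (tmul (s (stdBasis H k)) ψ)⟫_ℂ) ⟪φ, B ψ⟫_ℂ) :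
    IsRestriction (s ∘L s) T B := by
  intro ρ hρ
  obtain ⟨r, hr, rfl, hrHS⟩ := hρ.exists_sqrt
  have h1 := hasSum_trace_sq_comp hr hrHS B (stdBasis K)
  have h2 := hasSum_trace_sq_comp (s := tensorOp s r) (by rw [tensorOp_adjoint, hs, hr])
    (hHS.tensorOp hrHS) T (tensorBasis (stdBasis H) (stdBasis K))
  rw [← tensorOp_comp] at h2
  refine h1.unique ?_
  refine HasSum.prod_fiberwise ((Equiv.prodComm _ _).hasSum_iff.2 h2) fun j => ?_
  refine (hB (r (stdBasis K j)) (r (stdBasis K j))).congr_fun fun k => ?_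
  simp only [Function.comp_apply, Equiv.prodComm_apply, Prod.swap_prod_mk,
    tensorBasis_apply, tensorOp_tmul]

theorem existsUnique_isRestriction {ω : H →L[ℂ] H} (hω : IsState ω)
    (T : HilbertTensor H K →L[ℂ] HilbertTensor H K) : ∃! B : K →L[ℂ] K, IsRestriction ω T B := by
  obtain ⟨s, hs, rfl, hHS⟩ := hω.exists_sqrt
  obtain ⟨B, hB⟩ := exists_partial_expectation hHS T
  refine ⟨B, isRestriction_of_hasSum hs hHS hB, fun C hC => eq_of_forall_trace_eq fun ρ hρ => ?_⟩
  rw [hC ρ hρ, isRestriction_of_hasSum hs hHS hB ρ hρ]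

theorem isRestriction_restriction {ω : H →L[ℂ] H} (hω : IsState ω)
    (T : HilbertTensor H K →L[ℂ] HilbertTensor H K) : IsRestriction ω T (restriction ω T) := by
  have h := (existsUnique_isRestriction hω T).exists
  rw [restriction, dif_pos h]
  exact h.choose_spec

theorem exists_hasSum_inner_restriction {ω : H →L[ℂ] H} (hω : IsState ω) :
    ∃ s : H →L[ℂ] H, ContinuousLinearMap.adjoint s = s ∧ s ∘L s = ω ∧ IsHilbertSchmidt s ∧
      ∀ (T : HilbertTensor H K →L[ℂ] HilbertTensor H K) (φ ψ : K),
        HasSum (fun k => ⟪tmul (s (stdBasis H k)) φ, T (tmul (s (stdBasis H k)) ψ)⟫_ℂ)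
          ⟪φ, restriction ω T ψ⟫_ℂ := by
  obtain ⟨s, hs, rfl, hHS⟩ := hω.exists_sqrt
  refine ⟨s, hs, rfl, hHS, fun T => ?_⟩
  obtain ⟨B, hB⟩ := exists_partial_expectation hHS T
  rwa [(existsUnique_isRestriction hω T).unique (isRestriction_restriction hω T)
    (isRestriction_of_hasSum hs hHS hB)]

end Restriction

/-! ### Weak compactness of bounded sets of operators. -/

section WeakLimit

variable {V : Type*} [NormedAddCommGroup V] [InnerProductSpace ℂ V]

theorem opNorm_le_of_forall_inner {T : V →L[ℂ] V} {C : ℝ} (hC : 0 ≤ C)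
    (h : ∀ u v, ‖⟪u, T v⟫_ℂ‖ ≤ C * ‖u‖ * ‖v‖) : ‖T‖ ≤ C := by
  refine ContinuousLinearMap.opNorm_le_bound _ hC fun v => ?_
  rcases (norm_nonneg (T v)).eq_or_lt with h0 | h0
  · rw [← h0]; positivity
  have h1 := h (T v) v
  rw [inner_self_eq_norm_sq_to_K, norm_pow, RCLike.norm_ofReal, abs_norm] at h1
  nlinarith

/-- A bounded sequence of operators has a weak limit along every ultrafilter. -/
theorem exists_weak_limit [CompleteSpace V] (l : Ultrafilter ℕ) {Y : ℕ → V →L[ℂ] V} {C : ℝ}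
    (hY : ∀ n, ‖Y n‖ ≤ C) :
    ∃ Z : V →L[ℂ] V, ∀ u v, Tendsto (fun n => ⟪u, Y n v⟫_ℂ) l (𝓝 ⟪u, Z v⟫_ℂ) := by
  have hb : ∀ u v n, ‖⟪Y n u, v⟫_ℂ‖ ≤ C * ‖u‖ * ‖v‖ := fun u v n =>
    (norm_inner_le_norm _ _).trans (by gcongr; exact (Y n).le_of_opNorm_le (hY n) u)
  have hex : ∀ u v, ∃ z : ℂ, ‖z‖ ≤ C * ‖u‖ * ‖v‖ ∧
      Tendsto (fun n => ⟪Y n u, v⟫_ℂ) l (𝓝 z) := by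
    intro u v
    -- One ultrafilter serves all pairs `u`, `v` at once, so no subsequence is needed and
    -- sesquilinearity of `z` follows from uniqueness of limits.
    obtain ⟨z, hz, hlz⟩ := (isCompact_closedBall (0 : ℂ) (C * ‖u‖ * ‖v‖)).ultrafilter_le_nhds
      (l.map fun n => ⟪Y n u, v⟫_ℂ) (by
        rw [le_principal_iff]
        exact Filter.mem_map.2 (univ_mem' fun n : ℕ => by simpa using hb u v n))
    exact ⟨z, by simpa using hz, hlz⟩
  choose z hz hlim using hex
  let B : V →ₗ⋆[ℂ] V →ₗ[ℂ] ℂ := LinearMap.mk₂'ₛₗ (starRingEnd ℂ) (RingHom.id ℂ) z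
    (fun u u' v => tendsto_nhds_unique (hlim _ _)
      (((hlim u v).add (hlim u' v)).congr fun n => by rw [map_add, inner_add_left]))
    (fun c u v => tendsto_nhds_unique (hlim _ _)
      (((hlim u v).const_mul _).congr fun n => by rw [map_smul, inner_smul_left]))
    (fun u v v' => tendsto_nhds_unique (hlim _ _)
      (((hlim u v).add (hlim u v')).congr fun n => by rw [inner_add_right]))
    (fun c u v => tendsto_nhds_unique (hlim _ _)
      (((hlim u v).const_mul _).congr fun n => by rw [inner_smul_right]; rfl))
  let B' : V →L⋆[ℂ] V →L[ℂ] ℂ := B.mkContinuous₂ C hz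
  refine ⟨InnerProductSpace.continuousLinearMapOfBilin B', fun u v => ?_⟩
  have h1 : ⟪InnerProductSpace.continuousLinearMapOfBilin B' v, u⟫_ℂ = z v u :=
    InnerProductSpace.continuousLinearMapOfBilin_apply B' v u
  rw [← inner_conj_symm, h1]
  exact ((Complex.continuous_conj.tendsto _).comp (hlim v u)).congr fun n =>
    inner_conj_symm _ _

end WeakLimit

/-! ### Operator-valued integrals of simple functions. -/

section SimpleIntegral

variable {ι H K : Type*} [NormedAddCommGroup H] [InnerProductSpace ℂ H] [CompleteSpace H]
  [NormedAddCommGroup K] [InnerProductSpace ℂ K]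

/-- The norm of a finite operator-valued sum `∑ Pᵢ ⊗ Aᵢ` over a resolution `Pᵢ` of the identity. -/
theorem norm_sum_tensorOp_le [CompleteSpace K] {s : Finset ι} {P : ι → H →L[ℂ] H} (hP : ∀ i, (P i).IsPositive)
    (hsum : ∑ i ∈ s, P i = 1) {A : ι → K →L[ℂ] K} {C : ℝ} (hC : 0 ≤ C) (hA : ∀ i, ‖A i‖ ≤ C) :
    ‖∑ i ∈ s, tensorOp (P i) (A i)‖ ≤ C := by
  -- With `R i = r i ⊗ 1`, each term is `R i (1 ⊗ A i) R i` and `∑ ‖R i u‖ ^ 2 = ‖u‖ ^ 2`.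
  -- Cauchy–Schwarz then gives a bound independent of the number of terms.
  choose r hr hrr using fun i => exists_sqrt (hP i)
  set R : ι → HilbertTensor H K →L[ℂ] HilbertTensor H K := fun i => tensorOp (r i) 1 with hR
  have hRadj : ∀ i, ContinuousLinearMap.adjoint (R i) = R i := fun i => by
    rw [hR, tensorOp_adjoint, hr]
    congr 1
    exact star_one _
  have hRsum : ∀ u, ∑ i ∈ s, ‖R i u‖ ^ 2 = ‖u‖ ^ 2 := by
    intro u
    have h1 : ∑ i ∈ s, tensorOp (P i) (1 : K →L[ℂ] K) = 1 := by
      rw [← tensorOp_sum_left, hsum, tensorOp_one]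
    have h2 : ∀ i, tensorOp (P i) (1 : K →L[ℂ] K) = R i ∘L R i := fun i => by
      rw [hR, ← tensorOp_comp, hrr]
      rfl
    have h3 : ∑ i ∈ s, ⟪R i u, R i u⟫_ℂ = ⟪u, u⟫_ℂ := by
      have h4 := congrArg (fun D => ⟪u, D u⟫_ℂ) h1
      simpa only [h2, sum_apply, inner_sum, ContinuousLinearMap.comp_apply,
        inner_sq_self (hRadj _), one_apply_eq_self] using h4
    simp only [inner_self_eq_norm_sq_to_K] at h3
    exact_mod_cast h3
  have hterm : ∀ i, tensorOp (P i) (A i) = R i ∘L tensorOp 1 (A i) ∘L R i := fun i => by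
    rw [hR, ← tensorOp_comp, ← tensorOp_comp, ← hrr]
    rfl
  have hone : ∀ i, ‖tensorOp (1 : H →L[ℂ] H) (A i)‖ ≤ C := fun i =>
    (norm_tensorOp_le _ _).trans <| by
      calc ‖(1 : H →L[ℂ] H)‖ * ‖A i‖ ≤ 1 * C := by
            gcongr
            · exact ContinuousLinearMap.norm_id_le
            · exact hA i
        _ = C := one_mul C
  refine opNorm_le_of_forall_inner hC fun u v => ?_
  calc ‖⟪u, (∑ i ∈ s, tensorOp (P i) (A i)) v⟫_ℂ‖
      = ‖∑ i ∈ s, ⟪R i u, tensorOp 1 (A i) (R i v)⟫_ℂ‖ := by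
        simp only [sum_apply, inner_sum, hterm, ContinuousLinearMap.comp_apply]
        congr 1
        refine Finset.sum_congr rfl fun i _ => ?_
        rw [← ContinuousLinearMap.adjoint_inner_left (R i), hRadj]
    _ ≤ ∑ i ∈ s, C * (‖R i u‖ * ‖R i v‖) := by
        refine (norm_sum_le _ _).trans (Finset.sum_le_sum fun i _ => ?_)
        calc _ ≤ ‖R i u‖ * (C * ‖R i v‖) := (norm_inner_le_norm _ _).trans
              (by gcongr; exact ContinuousLinearMap.le_of_opNorm_le _ (hone i) _)
          _ = _ := by ring
    _ = C * ∑ i ∈ s, ‖R i u‖ * ‖R i v‖ := by rw [Finset.mul_sum]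
    _ ≤ C * (‖u‖ * ‖v‖) := by
        gcongr
        refine (Real.sum_mul_le_sqrt_mul_sqrt _ _ _).trans_eq ?_
        rw [hRsum, hRsum, Real.sqrt_sq (norm_nonneg _), Real.sqrt_sq (norm_nonneg _)]
    _ = C * ‖u‖ * ‖v‖ := by ring

variable {Ω : Type*} [MeasurableSpace Ω] (E : POVM Ω H)

theorem POVM.inner_effect_self {X : Set Ω} (hX : MeasurableSet X) (x : H) :
    ⟪x, E.effect X x⟫_ℂ = ((E.vectorMeasure x).real X : ℂ) := by
  have h := Complex.nonneg_iff.1 ((E.isPositive X hX).inner_nonneg_right x)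
  rw [Measure.real, E.vectorMeasure_apply x hX, ENNReal.toReal_ofReal h.1]
  exact Complex.ext rfl h.2.symm

instance POVM.isFiniteMeasure_vectorMeasure (x : H) : IsFiniteMeasure (E.vectorMeasure x) :=
  ⟨by rw [E.vectorMeasure_apply x MeasurableSet.univ]; exact ENNReal.ofReal_lt_top⟩

theorem POVM.sum_effect_preimage_singleton (f : SimpleFunc Ω ι) :
    ∑ i ∈ f.range, E.effect (f ⁻¹' {i}) = 1 := by
  refine ext_inner_self_right fun x => ?_
  rw [sum_apply, inner_sum, ← E.effect_univ, E.inner_effect_self MeasurableSet.univ]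
  simp only [E.inner_effect_self (f.measurableSet_fiber _)]
  rw [← Complex.ofReal_sum, sum_measureReal_preimage_singleton _
    (fun i _ => f.measurableSet_fiber i), SimpleFunc.coe_range, Set.preimage_range]

/-- The operator `∫ dE(a) ⊗ F(f(a))` of a simple function `f`. -/
def POVM.simpleIntegral (f : SimpleFunc Ω ι) (F : ι → K →L[ℂ] K) :
    HilbertTensor H K →L[ℂ] HilbertTensor H K :=
  ∑ i ∈ f.range, tensorOp (E.effect (f ⁻¹' {i})) (F i)

theorem POVM.norm_simpleIntegral_le [CompleteSpace K] (f : SimpleFunc Ω ι) {F : ι → K →L[ℂ] K} {C : ℝ}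
    (hC : 0 ≤ C) (hF : ∀ i, ‖F i‖ ≤ C) : ‖E.simpleIntegral f F‖ ≤ C :=
  norm_sum_tensorOp_le (fun _ => E.isPositive _ (f.measurableSet_fiber _))
    (E.sum_effect_preimage_singleton f) hC hF

/-- The defining formula of the relativization already holds exactly at the level of simple
functions; only a limit remains. -/
theorem POVM.inner_simpleIntegral (f : SimpleFunc Ω ι) (F : ι → K →L[ℂ] K) (x : H) (φ ψ : K) :
    ⟪tmul x φ, E.simpleIntegral f F (tmul x ψ)⟫_ℂ =
      ∫ a, ⟪φ, F (f a) ψ⟫_ℂ ∂(E.vectorMeasure x) := by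
  classical
  have h1 : (fun a => ⟪φ, F (f a) ψ⟫_ℂ) = fun a => ∑ i ∈ f.range,
      (f ⁻¹' {i}).indicator (fun _ => ⟪φ, F i ψ⟫_ℂ) a := by
    funext a
    rw [Finset.sum_eq_single (f a)]
    · simp
    · intro i _ hi
      exact Set.indicator_of_notMem (fun h => hi h.symm) _
    · exact fun h => absurd (f.mem_range_self a) h
  rw [h1, integral_finsetSum _ fun i _ =>
    (integrable_const _).indicator (f.measurableSet_fiber i)]
  simp only [POVM.simpleIntegral, sum_apply, inner_sum, tensorOp_tmul, inner_tmul]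
  refine Finset.sum_congr rfl fun i _ => ?_
  rw [integral_indicator_const _ (f.measurableSet_fiber i),
    E.inner_effect_self (f.measurableSet_fiber i), Complex.real_smul]

end SimpleIntegral

/-! ### The relativization map and its restriction to a state. -/

section Relativization

variable {G : Type*} [Group G] [TopologicalSpace G]
  {HS : Type*} [NormedAddCommGroup HS] [InnerProductSpace ℂ HS] [CompleteSpace HS]

theorem UnitaryRep.norm_act (U : UnitaryRep G HS) (g : G) (A : HS →L[ℂ] HS) :
    ‖U.act g A‖ = ‖A‖ :=
  (CStarRing.norm_coe_unitary_mul (U.toHom g) _).trans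
    (CStarRing.norm_mul_coe_unitary A (star (U.toHom g)))

theorem UnitaryRep.act_one (U : UnitaryRep G HS) (A : HS →L[ℂ] HS) : U.act 1 A = A := by
  have h : (U.toHom 1 : HS →L[ℂ] HS) = 1 := by rw [map_one]; rfl
  rw [UnitaryRep.act, h, ← ContinuousLinearMap.star_eq_adjoint, star_one]
  rfl

theorem UnitaryRep.norm_inner_act_le (U : UnitaryRep G HS) (A : HS →L[ℂ] HS) (φ ψ : HS) (g : G) :
    ‖⟪φ, U.act g A ψ⟫_ℂ‖ ≤ ‖A‖ * ‖φ‖ * ‖ψ‖ := by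
  calc _ ≤ ‖φ‖ * (‖A‖ * ‖ψ‖) := (norm_inner_le_norm _ _).trans
        (by gcongr; exact (U.act g A).le_of_opNorm_le (U.norm_act g A).le ψ)
    _ = _ := by ring

/-- Moving `U(g)` to the left vector leaves `U(g⁻¹)` on both vectors, where strong continuity
applies. -/
theorem UnitaryRep.continuous_inner_act [IsTopologicalGroup G] (U : UnitaryRep G HS)
    (A : HS →L[ℂ] HS) (φ ψ : HS) : Continuous fun g => ⟪φ, U.act g A ψ⟫_ℂ := by
  have h : ∀ g, ContinuousLinearMap.adjoint (U.toHom g : HS →L[ℂ] HS)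
      = (U.toHom g⁻¹ : HS →L[ℂ] HS) := fun g => by
    rw [map_inv]; rfl
  have e : ∀ g, ⟪φ, U.act g A ψ⟫_ℂ =
      ⟪(U.toHom g⁻¹ : HS →L[ℂ] HS) φ, A ((U.toHom g⁻¹ : HS →L[ℂ] HS) ψ)⟫_ℂ := fun g => by
    rw [← h, ContinuousLinearMap.adjoint_inner_left]
    rfl
  simp only [e]
  exact ((U.strongly_continuous φ).comp continuous_inv).inner
    (A.continuous.comp ((U.strongly_continuous ψ).comp continuous_inv))

variable [IsTopologicalGroup G] [MeasurableSpace G] [BorelSpace G]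
  {HR : Type*} [NormedAddCommGroup HR] [InnerProductSpace ℂ HR] [CompleteSpace HR]

/-- Approximate the identity map of `G` by simple functions. A weak limit exists only along an
ultrafilter a priori, but the integrals converge along `atTop` by dominated convergence, which
identifies its matrix coefficients. -/
theorem exists_isRelativization [SecondCountableTopology G] (R : PrincipalFrame G HR)
    (U : UnitaryRep G HS) (A : HS →L[ℂ] HS) : ∃ Y, IsRelativization R U A Y := by
  have hm : StronglyMeasurable (id : G → G) := stronglyMeasurable_id
  set Y := fun n => R.obs.simpleIntegral (hm.approx n) fun g => U.act g A
  obtain ⟨Z, hZ⟩ := exists_weak_limit (hyperfilter ℕ) (Y := Y) fun n =>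
    R.obs.norm_simpleIntegral_le (hm.approx n) (norm_nonneg A) fun g => (U.norm_act g A).le
  refine ⟨Z, fun x φ ψ => tendsto_nhds_unique (hZ _ _) (Tendsto.mono_left ?_
    Nat.hyperfilter_le_atTop)⟩
  simp only [Y, POVM.inner_simpleIntegral]
  have hc := U.continuous_inner_act A φ ψ
  refine tendsto_integral_of_dominated_convergence (fun _ => ‖A‖ * ‖φ‖ * ‖ψ‖) (fun n => ?_)
    (integrable_const _) (fun n => .of_forall fun g => U.norm_inner_act_le A φ ψ _)
    (.of_forall fun g => (hc.tendsto g).comp (hm.tendsto_approx g))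
  exact (hc.comp_stronglyMeasurable (hm.approx n).stronglyMeasurable).aestronglyMeasurable

/-- For fixed `φ`, `ψ` compress to an operator on `HR`; by complex polarization its quadratic form
determines it. -/
theorem IsRelativization.unique {R : PrincipalFrame G HR} {U : UnitaryRep G HS}
    {A : HS →L[ℂ] HS} {Y Z : HilbertTensor HR HS →L[ℂ] HilbertTensor HR HS}
    (hY : IsRelativization R U A Y) (hZ : IsRelativization R U A Z) : Y = Z := by
  refine ext_inner_tmul fun x φ y ψ => ?_
  set Bφ := (tmulBilin HR HS).flip φ
  set Bψ := (tmulBilin HR HS).flip ψ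
  set D : (HilbertTensor HR HS →L[ℂ] HilbertTensor HR HS) → HR →L[ℂ] HR :=
    fun W => ContinuousLinearMap.adjoint Bφ ∘L W ∘L Bψ
  have hD : ∀ W x y, ⟪x, D W y⟫_ℂ = ⟪tmul x φ, W (tmul y ψ)⟫_ℂ := fun W x y =>
    ContinuousLinearMap.adjoint_inner_right Bφ _ _
  have h : D Y = D Z := ext_inner_self_right fun x => by rw [hD, hD, hY, hZ]
  rw [← hD, h, hD]

theorem isRelativization_relativization [SecondCountableTopology G] (R : PrincipalFrame G HR)
    (U : UnitaryRep G HS) (A : HS →L[ℂ] HS) : IsRelativization R U A (relativization R U A) := by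
  have h := exists_isRelativization R U A
  rw [relativization, dif_pos h]
  exact h.choose_spec

/-- Evaluate `tr[s² E(X)]` as the sum of the expectations of `E(X)` at the vectors `s bₖ`. -/
theorem POVM.IsBornMeasure.eq_sum {Ω : Type*} [MeasurableSpace Ω] {E : POVM Ω HR}
    {s : HR →L[ℂ] HR} (hs : ContinuousLinearMap.adjoint s = s) (hHS : IsHilbertSchmidt s)
    {μ : ProbabilityMeasure Ω} (hμ : E.IsBornMeasure (s ∘L s) μ) :
    (μ : Measure Ω) = Measure.sum fun k => E.vectorMeasure (s (stdBasis HR k)) := by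
  ext X hX
  have h := hasSum_trace_sq_comp hs hHS (E.effect X) (stdBasis HR)
  rw [← hμ X hX] at h
  simp only [E.inner_effect_self hX] at h
  have h' := Complex.hasSum_ofReal.1 h
  rw [Measure.sum_apply _ hX, ← ofReal_measureReal, ← h'.tsum_eq,
    ENNReal.ofReal_tsum_of_nonneg (fun _ => measureReal_nonneg) h'.summable]
  exact tsum_congr fun k => ofReal_measureReal

/-- In a state `ω` the restricted relativization averages `g.A` over the distribution of the
frame observable. -/
theorem inner_restriction_relativization [SecondCountableTopology G] (R : PrincipalFrame G HR)
    (U : UnitaryRep G HS) (A : HS →L[ℂ] HS) {ω : HR →L[ℂ] HR} (hω : IsState ω)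
    {μ : ProbabilityMeasure G} (hμ : R.obs.IsBornMeasure ω μ) (φ ψ : HS) :
    ⟪φ, restriction ω (relativization R U A) ψ⟫_ℂ = ∫ g, ⟪φ, U.act g A ψ⟫_ℂ ∂(μ : Measure G) := by
  obtain ⟨s, hs, rfl, hHS, h⟩ := exists_hasSum_inner_restriction (K := HS) hω
  have h1 := h (relativization R U A) φ ψ
  simp only [isRelativization_relativization R U A _ φ ψ] at h1
  have hint : Integrable (fun g => ⟪φ, U.act g A ψ⟫_ℂ) (μ : Measure G) :=
    Integrable.of_bound (U.continuous_inner_act A φ ψ).aestronglyMeasurable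
      (‖A‖ * ‖φ‖ * ‖ψ‖) (.of_forall fun g => U.norm_inner_act_le A φ ψ g)
  have e := hμ.eq_sum hs hHS
  rw [e] at hint ⊢
  exact h1.unique (hasSum_integral_measure hint)

end Relativization

end

end QRF

/-- The first two conclusions say that the relativization of `A` and the restriction maps
are well defined; the last one is the ultraweak convergence. -/
theorem theorem3p1
    {G : Type*} [Group G] [TopologicalSpace G] [IsTopologicalGroup G] [LocallyCompactSpace G]
    [SecondCountableTopology G] [MeasurableSpace G] [BorelSpace G]
    {HR : Type*} [NormedAddCommGroup HR] [InnerProductSpace ℂ HR] [CompleteSpace HR]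
    [TopologicalSpace.SeparableSpace HR]
    {HS : Type*} [NormedAddCommGroup HS] [InnerProductSpace ℂ HS] [CompleteSpace HS]
    [TopologicalSpace.SeparableSpace HS]
    (R : QRF.PrincipalFrame G HR) (hR : R.obs.IsLocalizable)
    (U : QRF.UnitaryRep G HS)
    (ω : ℕ → HR →L[ℂ] HR) (hω : R.obs.IsLocalizingSequence 1 ω)
    (A : HS →L[ℂ] HS) :
    (∃! Y, QRF.IsRelativization R U A Y) ∧
    (∀ (n : ℕ) (T : QRF.HilbertTensor HR HS →L[ℂ] QRF.HilbertTensor HR HS),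
      ∃! B : HS →L[ℂ] HS, QRF.IsRestriction (ω n) T B) ∧
    QRF.UltraweakTendsto (fun n => QRF.restriction (ω n) (QRF.relativization R U A)) A := by
  obtain ⟨hstate, μ, hμ, hlim⟩ := hω
  have key := fun n => QRF.inner_restriction_relativization R U A (hstate n) (hμ n)
  refine ⟨⟨QRF.relativization R U A, QRF.isRelativization_relativization R U A,
    fun Y hY => hY.unique (QRF.isRelativization_relativization R U A)⟩,
    fun n T => QRF.existsUnique_isRestriction (hstate n) T,
    QRF.ultraweakTendsto_of_weak (C := ‖A‖) (fun n => ?_) fun φ ψ => ?_⟩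
  -- The uniform bound `‖A‖` survives averaging because `μ n` has total mass one.
  · refine QRF.opNorm_le_of_forall_inner (norm_nonneg A) fun φ ψ => ?_
    rw [key]
    refine (norm_integral_le_of_norm_le_const
      (.of_forall fun g => U.norm_inner_act_le A φ ψ g)).trans_eq ?_
    simp
  · simp only [key]
    -- The test function for weak convergence; its value at the identity is `⟪φ, A ψ⟫`.
    let f : BoundedContinuousFunction G ℂ :=
      BoundedContinuousFunction.ofNormedAddCommGroup (fun g => ⟪φ, U.act g A ψ⟫_ℂ)
        (U.continuous_inner_act A φ ψ) (‖A‖ * ‖φ‖ * ‖ψ‖) (U.norm_inner_act_le A φ ψ)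
    have h := (ProbabilityMeasure.tendsto_iff_forall_integral_rclike_tendsto ℂ).1 hlim f
    have e : ∫ g, f g ∂(diracProba (1 : G) : Measure G) = ⟪φ, A ψ⟫_ℂ := by
      refine (integral_dirac' _ _ f.continuous.stronglyMeasurable).trans ?_
      change ⟪φ, U.act 1 A ψ⟫_ℂ = _
      rw [U.act_one]
    rw [e] at h
    exact h
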